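/- All graphs are finite and simple. Let $P_5$ be the path on five vertices, and let the chair be the graph obtained from the path on four vertices by adding one new vertex adjacent to exactly one vertex of the path, namely one of its two middle vertices. A graph is $(P_5,\text{chair})$-free if it has no induced subgraph isomorphic to $P_5$ and no induced subgraph isomorphic to the chair. A graph $G$ is $5$-vertex-critical if $\chi(G)=5$ and $\chi(G-v)<5$ for every vertex $v$ of $G$. Theorem. Up to isomorphism, there are only finitely many $5$-vertex-critical $(P_5,\text{chair})$-free graphs. -/

import Mathlib

/-- The chair: the path `0 - 1 - 2 - 3` on four vertices, together with an additional vertex `4`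
whose only neighbour is the middle vertex `1` of that path. -/
def chairGraph : SimpleGraph (Fin 5) :=
  SimpleGraph.fromEdgeSet {s(0, 1), s(1, 2), s(2, 3), s(1, 4)}

/-- `G` is `H`-free: no induced subgraph of `G` is isomorphic to `H`. -/
def SimpleGraph.IndFree {V W : Type*} (G : SimpleGraph V) (H : SimpleGraph W) : Prop :=
  ¬ H.IsIndContained G

/-- `G` is `k`-vertex-critical: its chromatic number is `k`, and deleting any vertex gives a graph
of chromatic number less than `k`. -/
def SimpleGraph.IsVertexCritical {V : Type*} (G : SimpleGraph V) (k : ℕ) : Prop :=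
  G.chromaticNumber = k ∧ ∀ v : V, (G.induce {v}ᶜ).chromaticNumber < k

open SimpleGraph

/-! ### Forbidden configurations and short walks. -/

section PathsAndChairs

variable {V : Type*} {G : SimpleGraph V}

/-! Let `I` be a maximum independent set. Five colour classes cover the graph, so it suffices to
bound `I`. Vertices outside `I` are compared through their traces on `I`: non-adjacent vertices with
meeting traces have nested traces differing in at most one vertex (`nested_of_not_adj`,
`eq_of_not_adj`). The engine is `exists_large_trace`: if `T` is `I` or a large trace, some trace
strictly inside `T` has about a sixth of its size. Otherwise `G.below I T` splits into at least
seven components meeting `T`. At most five contain exceptional vertices of `T`, and two of the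
others are anticomplete modules with equal outside neighbourhoods, which criticality forbids
(`false_of_twin_modules`). Iterating gives nested traces with large gaps, whose vertices are forced
to be adjacent; a huge `I` would thus yield a clique on six vertices, impossible in a 5-colourable
graph. -/

/-- Vertices inducing a path on five vertices contradict `P₅`-freeness. -/
theorem SimpleGraph.IndFree.false_of_path (h : G.IndFree (pathGraph 5)) {a b c d e : V}
    (hab : G.Adj a b) (hbc : G.Adj b c) (hcd : G.Adj c d) (hde : G.Adj d e)
    (hac : ¬ G.Adj a c) (had : ¬ G.Adj a d) (hae : ¬ G.Adj a e)
    (hbd : ¬ G.Adj b d) (hbe : ¬ G.Adj b e) (hce : ¬ G.Adj c e) : False := by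
  have key : ∀ i j : Fin 5, G.Adj (![a, b, c, d, e] i) (![a, b, c, d, e] j) ↔
      (pathGraph 5).Adj i j := by
    intro i j
    rw [pathGraph_adj]
    fin_cases i <;> fin_cases j <;> simp_all [G.adj_comm]
  have inj : Function.Injective ![a, b, c, d, e] := by
    have h1 := hab.ne; have h2 := hbc.ne; have h3 := hcd.ne; have h4 := hde.ne
    have h5 : a ≠ c := by rintro rfl; exact had hcd
    have h6 : a ≠ d := by rintro rfl; exact hae hde
    have h7 : a ≠ e := by rintro rfl; exact had hde.symm
    have h8 : b ≠ d := by rintro rfl; exact had hab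
    have h9 : b ≠ e := by rintro rfl; exact hae hab
    have h10 : c ≠ e := by rintro rfl; exact hbe hbc
    intro i j hij
    fin_cases i <;> fin_cases j <;> simp_all
  exact h ⟨⟨⟨_, inj⟩, fun {i j} => key i j⟩⟩

/-- A vertex `c` with two further neighbours `a`, `b`, and a path `c - p - q`, inducing a chair,
contradict chair-freeness. -/
theorem SimpleGraph.IndFree.false_of_chair (h : G.IndFree chairGraph) {a b c p q : V}
    (hca : G.Adj c a) (hcb : G.Adj c b) (hcp : G.Adj c p) (hpq : G.Adj p q) (hne : a ≠ b)
    (hab : ¬ G.Adj a b) (hap : ¬ G.Adj a p) (hbp : ¬ G.Adj b p)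
    (haq : ¬ G.Adj a q) (hbq : ¬ G.Adj b q) (hcq : ¬ G.Adj c q) : False := by
  have key : ∀ i j : Fin 5, G.Adj (![a, c, p, q, b] i) (![a, c, p, q, b] j) ↔
      chairGraph.Adj i j := by
    intro i j
    rw [chairGraph, fromEdgeSet_adj]
    fin_cases i <;> fin_cases j <;> simp_all [G.adj_comm]
  have inj : Function.Injective ![a, c, p, q, b] := by
    have h1 := hca.ne; have h2 := hcb.ne; have h3 := hcp.ne; have h4 := hpq.ne
    have h5 : a ≠ p := by rintro rfl; exact haq hpq
    have h6 : a ≠ q := by rintro rfl; exact hcq hca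
    have h7 : b ≠ p := by rintro rfl; exact hbq hpq
    have h8 : b ≠ q := by rintro rfl; exact hcq hcb
    have h9 : c ≠ q := by rintro rfl; exact haq hca.symm
    intro i j hij
    fin_cases i <;> fin_cases j <;> simp_all
  exact h ⟨⟨⟨_, inj⟩, fun {i j} => key i j⟩⟩

/-- In a `P₅`-free graph, vertices joined by a walk inside `S` are joined by a walk of length at
most three inside `S`. -/
theorem SimpleGraph.IndFree.short_walk (h : G.IndFree (pathGraph 5)) {S : Set V} {a b : V}
    (hab : Relation.ReflTransGen (fun u v => G.Adj u v ∧ v ∈ S) a b) :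
    a = b ∨ G.Adj a b ∨ (∃ p ∈ S, G.Adj a p ∧ G.Adj p b) ∨
      ∃ p ∈ S, ∃ q ∈ S, G.Adj a p ∧ G.Adj p q ∧ G.Adj q b := by
  suffices H : (a = b ∨ (b ∈ S ∧ (G.Adj a b ∨ (∃ p ∈ S, G.Adj a p ∧ G.Adj p b) ∨
      ∃ p ∈ S, ∃ q ∈ S, G.Adj a p ∧ G.Adj p q ∧ G.Adj q b))) from
    H.imp_right And.right
  induction hab with
  | refl => exact Or.inl rfl
  | @tail c d _ hcd ih =>
    obtain ⟨hcd, hd⟩ := hcd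
    refine Or.inr ⟨hd, ?_⟩
    rcases ih with rfl | ⟨hc, hac | ⟨p, hp, hap, hpc⟩ | ⟨p, hp, q, hq, hap, hpq, hqc⟩⟩
    · exact Or.inl hcd
    · exact Or.inr (Or.inl ⟨c, hc, hac, hcd⟩)
    · exact Or.inr (Or.inr ⟨p, hp, c, hc, hap, hpc, hcd⟩)
    -- The walk `a - p - q - c - d` is not an induced path, so some chord shortens it.
    · by_cases h1 : G.Adj a q
      · exact Or.inr (Or.inr ⟨q, hq, c, hc, h1, hqc, hcd⟩)
      by_cases h2 : G.Adj a c
      · exact Or.inr (Or.inl ⟨c, hc, h2, hcd⟩)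
      by_cases h3 : G.Adj a d
      · exact Or.inl h3
      by_cases h4 : G.Adj p c
      · exact Or.inr (Or.inr ⟨p, hp, c, hc, hap, h4, hcd⟩)
      by_cases h5 : G.Adj p d
      · exact Or.inr (Or.inl ⟨p, hp, hap, h5⟩)
      by_cases h6 : G.Adj q d
      · exact Or.inr (Or.inr ⟨p, hp, q, hq, hap, hpq, h6⟩)
      exact (h.false_of_path hap hpq hqc hcd h1 h2 h3 h4 h5 h6).elim

end PathsAndChairs

/-! ### Vertex-critical graphs. -/

section Critical

variable {V : Type*} {G : SimpleGraph V}

theorem SimpleGraph.IsVertexCritical.exists_coloring_off (h : G.IsVertexCritical 5) (v : V) :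
    ∃ c : V → Fin 4, ∀ a b, a ≠ v → b ≠ v → G.Adj a b → c a ≠ c b := by
  have h1 : (G.induce {v}ᶜ).chromaticNumber ≤ (4 : ℕ) := by
    have h2 := h.2 v
    rw [show ((5 : ℕ) : ℕ∞) = ((4 : ℕ) : ℕ∞) + 1 by norm_num] at h2
    exact Order.le_of_lt_add_one h2
  obtain ⟨c⟩ := chromaticNumber_le_iff_colorable.1 h1
  classical
  refine ⟨fun a => if ha : a ≠ v then c ⟨a, ha⟩ else 0, fun a b ha hb hab => ?_⟩
  simp only [dif_pos ha, dif_pos hb]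
  exact c.valid hab

theorem SimpleGraph.IsVertexCritical.false_of_coloring (h : G.IsVertexCritical 5)
    (c : V → Fin 4) (hc : ∀ a b, G.Adj a b → c a ≠ c b) : False := by
  have h1 : G.chromaticNumber ≤ (4 : ℕ) :=
    chromaticNumber_le_iff_colorable.2 ⟨Coloring.mk c fun {a b} hab => hc a b hab⟩
  rw [h.1] at h1
  exact absurd h1 (by norm_num)

theorem SimpleGraph.IsVertexCritical.clique_card_le (h : G.IsVertexCritical 5) (s : Finset V)
    (hs : G.IsClique s) : s.card ≤ 5 := by
  have h1 : G.Colorable 5 := chromaticNumber_le_iff_colorable.1 h.1.le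
  exact hs.card_le_of_colorable h1

/-- In a critical graph, there are no two anticomplete modules with the same neighbourhood. -/
theorem SimpleGraph.IsVertexCritical.false_of_twin_modules (h : G.IsVertexCritical 5)
    {M₁ M₂ : Set V} (h₁ : M₁.Nonempty) (h₂ : M₂.Nonempty) (hd : Disjoint M₁ M₂)
    (hanti : ∀ a ∈ M₁, ∀ b ∈ M₂, ¬ G.Adj a b)
    (hmod : ∀ z, z ∉ M₁ → z ∉ M₂ → ∀ v ∈ M₁ ∪ M₂, G.Adj z v → ∀ w ∈ M₁ ∪ M₂, G.Adj z w) :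
    False := by
  classical
  obtain ⟨x, hx⟩ := h₁
  obtain ⟨y, hy⟩ := h₂
  obtain ⟨c, hc⟩ := h.exists_coloring_off x
  obtain ⟨c', hc'⟩ := h.exists_coloring_off y
  have glue : ∀ (A B : Set V) (a b : V) (c c' : V → Fin 4), a ∈ A → b ∈ B → Disjoint A B →
      (∀ a ∈ A, ∀ b ∈ B, ¬ G.Adj a b) →
      (∀ z, z ∉ A → z ∉ B → ∀ v ∈ A, G.Adj z v → ∀ w ∈ B, G.Adj z w) →
      (∀ u v, u ≠ a → v ≠ a → G.Adj u v → c u ≠ c v) →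
      (∀ u v, u ≠ b → v ≠ b → G.Adj u v → c' u ≠ c' v) →
      (Finset.univ.filter fun i => ∃ v ∈ A, c' v = i).card ≤
        (Finset.univ.filter fun i => ∃ v ∈ B, c v = i).card → False := by
    intro A B a b c c' ha hb hd hanti hmod hc hc' hcard
    -- `f` injects the colours of `c'` on `A` into those of `c` on `B`. Outside neighbours of `A`
    -- see all of `B`, so `f ∘ c'` on `A` is compatible with `c` elsewhere.
    obtain ⟨f, hf, hinj⟩ : ∃ f : Fin 4 → Fin 4,
        (∀ i, (∃ v ∈ A, c' v = i) → ∃ v ∈ B, c v = f i) ∧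
        (∀ i j, (∃ v ∈ A, c' v = i) → (∃ v ∈ A, c' v = j) → f i = f j → i = j) := by
      rw [← Fintype.card_coe, ← Fintype.card_coe] at hcard
      obtain ⟨e⟩ := Function.Embedding.nonempty_of_card_le hcard
      have hmem : ∀ i, (∃ v ∈ A, c' v = i) →
          i ∈ Finset.univ.filter fun i => ∃ v ∈ A, c' v = i := fun i hi => by simpa using hi
      refine ⟨fun i => if hi : ∃ v ∈ A, c' v = i then e ⟨i, hmem i hi⟩ else 0, ?_, ?_⟩
      · intro i hi
        simp only [dif_pos hi]
        exact (Finset.mem_filter.1 (e ⟨i, hmem i hi⟩).2).2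
      · intro i j hi hj hij
        simp only [dif_pos hi, dif_pos hj] at hij
        exact congrArg Subtype.val (e.injective (Subtype.ext hij))
    have hAb : ∀ v ∈ A, v ≠ b := fun v hv hvb => Set.disjoint_left.1 hd hv (hvb ▸ hb)
    have hout : ∀ u v, u ∈ A → v ∉ A → G.Adj u v → f (c' u) ≠ c v := by
      intro u v hu hv huv heq
      obtain ⟨w, hw, hwc⟩ := hf _ ⟨u, hu, rfl⟩
      have hvB : v ∉ B := fun hvB => hanti u hu v hvB huv
      refine hc v w (fun e => hv (e ▸ ha)) (fun e => Set.disjoint_left.1 hd ha (e ▸ hw))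
        (hmod v hv hvB u hu huv.symm w hw) ?_
      rw [hwc, heq]
    refine h.false_of_coloring (fun v => if v ∈ A then f (c' v) else c v) fun u v huv => ?_
    by_cases hu : u ∈ A <;> by_cases hv : v ∈ A <;> simp only [hu, hv, if_true, if_false]
    · exact fun e => hc' u v (hAb u hu) (hAb v hv) huv (hinj _ _ ⟨u, hu, rfl⟩ ⟨v, hv, rfl⟩ e)
    · exact hout u v hu hv huv
    · exact (hout v u hv hu huv.symm).symm
    · exact hc u v (fun e => hu (e ▸ ha)) (fun e => hv (e ▸ ha)) huv
  rcases le_total (Finset.univ.filter fun i => ∃ v ∈ M₁, c' v = i).card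
    (Finset.univ.filter fun i => ∃ v ∈ M₂, c v = i).card with hle | hle
  · exact glue M₁ M₂ x y c c' hx hy hd hanti
      (fun z h1 h2 v hv hzv w hw => hmod z h1 h2 v (Or.inl hv) hzv w (Or.inr hw)) hc hc' hle
  · exact glue M₂ M₁ y x c' c hy hx hd.symm (fun a ha b hb hab => hanti b hb a ha hab.symm)
      (fun z h1 h2 v hv hzv w hw => hmod z h2 h1 v (Or.inr hv) hzv w (Or.inl hw)) hc' hc hle

end Critical

/-! ### Traces on a maximal independent set. -/

section Traces

open scoped Classical in
/-- The neighbours of `v` in the finite set `I`. -/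
noncomputable def SimpleGraph.trace {V : Type*} (G : SimpleGraph V) (I : Finset V) (v : V) :
    Finset V :=
  I.filter (G.Adj v)

/-- `I` is a maximal independent set of the `(P₅, chair)`-free graph `G`, whose cliques have at
most five vertices. -/
structure SimpleGraph.IsAnchor {V : Type*} (G : SimpleGraph V) (I : Finset V) : Prop where
  path_free : G.IndFree (pathGraph 5)
  chair_free : G.IndFree chairGraph
  indep : ∀ a ∈ I, ∀ b ∈ I, ¬ G.Adj a b
  dominating : ∀ v ∉ I, ∃ x ∈ I, G.Adj v x
  clique_card_le : ∀ s : Finset V, G.IsClique s → s.card ≤ 5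

/-- The vertices of `T` together with the vertices outside `I` whose trace is strictly inside
`T`. -/
def SimpleGraph.below {V : Type*} (G : SimpleGraph V) (I T : Finset V) : Set V :=
  {v | v ∈ T ∨ v ∉ I ∧ G.trace I v ⊂ T}

/-- Connectedness by a walk inside `G.below I T`. -/
def SimpleGraph.Linked {V : Type*} (G : SimpleGraph V) (I T : Finset V) : V → V → Prop :=
  Relation.ReflTransGen fun u v => G.Adj u v ∧ v ∈ G.below I T

open scoped Classical in
/-- The vertices of `T` linked to `x`. -/
noncomputable def SimpleGraph.linkClass {V : Type*} (G : SimpleGraph V) (I T : Finset V) (x : V) :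
    Finset V :=
  T.filter (G.Linked I T x)

variable {V : Type*} {G : SimpleGraph V} {I T : Finset V} {v w x y z a b c : V}

theorem SimpleGraph.mem_trace : x ∈ G.trace I v ↔ x ∈ I ∧ G.Adj v x := by
  simp [trace]

theorem SimpleGraph.trace_subset : G.trace I v ⊆ I := fun _ hx => (mem_trace.1 hx).1

theorem SimpleGraph.mem_linkClass : y ∈ G.linkClass I T x ↔ y ∈ T ∧ G.Linked I T x y := by
  simp [linkClass]

theorem SimpleGraph.Linked.mem_below (h : G.Linked I T x y) (hx : x ∈ G.below I T) :
    y ∈ G.below I T := by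
  induction h with
  | refl => exact hx
  | tail _ h _ => exact h.2

theorem SimpleGraph.Linked.symm (h : G.Linked I T x y) (hx : x ∈ G.below I T) :
    G.Linked I T y x := by
  induction h with
  | refl => exact .refl
  | @tail c d hxc hcd ih => exact .head ⟨hcd.1.symm, Linked.mem_below hxc hx⟩ ih

namespace SimpleGraph.IsAnchor

variable (hI : G.IsAnchor I)
include hI

theorem card_le_of_pairwise_adj {D : Finset V} (f : V → V)
    (hf : ∀ x ∈ D, ∀ y ∈ D, x ≠ y → G.Adj (f x) (f y)) : D.card ≤ 5 := by
  classical
  have hinj : Set.InjOn f D := fun x hx y hy hxy => by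
    by_contra hne
    exact (hf x hx y hy hne).ne hxy
  rw [← Finset.card_image_of_injOn hinj]
  refine hI.clique_card_le _ ?_
  intro u hu v hv huv
  obtain ⟨x, hx, rfl⟩ := Finset.mem_image.1 (Finset.mem_coe.1 hu)
  obtain ⟨y, hy, rfl⟩ := Finset.mem_image.1 (Finset.mem_coe.1 hv)
  exact hf x hx y hy fun e => huv (e ▸ rfl)

theorem trace_nonempty (hv : v ∉ I) : (G.trace I v).Nonempty := by
  obtain ⟨x, hx, hvx⟩ := hI.dominating v hv
  exact ⟨x, mem_trace.2 ⟨hx, hvx⟩⟩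

/-- Private neighbours `a`, `c` would give the induced path `a - v - b - w - c`. -/
theorem nested_of_not_adj (hvw : ¬ G.Adj v w) (hv : b ∈ G.trace I v) (hw : b ∈ G.trace I w) :
    G.trace I v ⊆ G.trace I w ∨ G.trace I w ⊆ G.trace I v := by
  by_contra! h
  obtain ⟨⟨a, hav, haw⟩, c, hcw, hcv⟩ := And.imp Finset.not_subset.1 Finset.not_subset.1 h
  rw [mem_trace] at *
  have := hI.indep
  exact hI.path_free.false_of_path hav.2.symm hv.2 hw.2.symm hcw.2 (this _ hav.1 _ hv.1)
    (fun e => haw ⟨hav.1, e.symm⟩) (this _ hav.1 _ hcw.1) hvw (fun e => hcv ⟨hcw.1, e⟩)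
    (this _ hv.1 _ hcw.1)

/-- Otherwise `w` is the centre of a chair with leaves `a`, `c` and long arm `w - b - v`. -/
theorem eq_of_not_adj (hvw : ¬ G.Adj v w) (hv : b ∈ G.trace I v) (hw : b ∈ G.trace I w)
    (ha : a ∈ G.trace I w) (hav : a ∉ G.trace I v) (hc : c ∈ G.trace I w)
    (hcv : c ∉ G.trace I v) : a = c := by
  by_contra hne
  rw [mem_trace] at *
  have := hI.indep
  exact hI.chair_free.false_of_chair ha.2 hc.2 hw.2 hv.2.symm hne (this _ ha.1 _ hc.1)
    (this _ ha.1 _ hv.1) (this _ hc.1 _ hv.1) (fun e => hav ⟨ha.1, e.symm⟩)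
    (fun e => hcv ⟨hc.1, e.symm⟩) (fun e => hvw e.symm)

/-- Otherwise `v` is the centre of a chair with leaves `a`, `b` and long arm `v - w - c`. -/
theorem eq_of_adj (hvw : G.Adj v w) (ha : a ∈ G.trace I v) (haw : a ∉ G.trace I w)
    (hb : b ∈ G.trace I v) (hbw : b ∉ G.trace I w) (hc : c ∈ G.trace I w)
    (hcv : c ∉ G.trace I v) : a = b := by
  by_contra hne
  rw [mem_trace] at *
  have := hI.indep
  exact hI.chair_free.false_of_chair ha.2 hb.2 hvw hc.2 hne (this _ ha.1 _ hb.1)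
    (fun e => haw ⟨ha.1, e.symm⟩) (fun e => hbw ⟨hb.1, e.symm⟩) (this _ ha.1 _ hc.1)
    (this _ hb.1 _ hc.1) (fun e => hcv ⟨hc.1, e⟩)

/-! ### Sizes of link classes. -/

/-- Each vertex `x` linked to `w`, where `w` has a trace of maximum size in its class, is reached
through an edge from a vertex with the same trace as `w`. -/
theorem exists_edge_to (hw : w ∉ I)
    (hmax : ∀ v, v ∉ I → G.trace I v ⊂ T → G.Linked I T w v →
      (G.trace I v).card ≤ (G.trace I w).card)
    (hTI : T ⊆ I) (hx : x ∈ T) (hxw : x ∉ G.trace I w) (hl : G.Linked I T w x) :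
    ∃ p q, G.trace I p = G.trace I w ∧ G.Adj p q ∧ x ∈ G.trace I q ∧
      (∀ y ∈ G.trace I q, y ∉ G.trace I w → y = x) ∧
      (p = w ∨ Disjoint (G.trace I w) (G.trace I q)) := by
  have hxI := hTI hx
  have hnsub : ∀ q, q ∉ I → G.trace I q ⊂ T → G.Linked I T w q → x ∈ G.trace I q →
      ¬ G.trace I w ⊆ G.trace I q := fun q hq hqT hlq hxq hsub =>
    hxw (Finset.eq_of_subset_of_card_le hsub (hmax q hq hqT hlq) ▸ hxq)
  have hedge : ∀ p q, q ∉ I → G.trace I q ⊂ T → G.Linked I T w q → x ∈ G.trace I q →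
      G.trace I p = G.trace I w → G.Adj p q →
      ∀ y ∈ G.trace I q, y ∉ G.trace I w → y = x := by
    intro p q hq hqT hlq hxq hp hpq y hy hyw
    obtain ⟨c, hcw, hcq⟩ := Finset.not_subset.1 (hnsub q hq hqT hlq hxq)
    exact hI.eq_of_adj hpq.symm hy (hp ▸ hyw) hxq (hp ▸ hxw) (hp ▸ hcw) hcq
  have houter : ∀ q ∈ G.below I T, G.Adj q x → q ∉ I ∧ G.trace I q ⊂ T := fun q hq hqx =>
    hq.resolve_left fun h => hI.indep _ (hTI h) _ hxI hqx
  have htwo : ∀ q ∈ G.below I T, G.Adj w q → G.Adj q x → ∃ p q, G.trace I p = G.trace I w ∧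
      G.Adj p q ∧ x ∈ G.trace I q ∧ (∀ y ∈ G.trace I q, y ∉ G.trace I w → y = x) ∧
      (p = w ∨ Disjoint (G.trace I w) (G.trace I q)) := by
    intro q hq hwq hqx
    have hxq : x ∈ G.trace I q := mem_trace.2 ⟨hxI, hqx⟩
    obtain ⟨hqI, hqT⟩ := houter q hq hqx
    exact ⟨w, q, rfl, hwq, hxq, hedge w q hqI hqT (.single ⟨hwq, hq⟩) hxq rfl hwq, Or.inl rfl⟩
  rcases hI.path_free.short_walk hl with rfl | h | ⟨q, hq, hwq, hqx⟩ |
    ⟨p, hp, q, hq, hwp, hpq, hqx⟩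
  · exact (hw hxI).elim
  · exact (hxw (mem_trace.2 ⟨hxI, h⟩)).elim
  · exact htwo q hq hwq hqx
  · by_cases hwq : G.Adj w q
    · exact htwo q hq hwq hqx
    by_cases hpx : G.Adj p x
    · exact htwo p hp hwp hpx
    have hxq : x ∈ G.trace I q := mem_trace.2 ⟨hxI, hqx⟩
    obtain ⟨hqI, hqT⟩ := houter q hq hqx
    have hlq : G.Linked I T w q := .tail (.single ⟨hwp, hp⟩) ⟨hpq, hq⟩
    have hdisj : Disjoint (G.trace I w) (G.trace I q) := by
      rw [Finset.disjoint_left]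
      intro b hbw hbq
      rcases hI.nested_of_not_adj hwq hbw hbq with h | h
      · exact hnsub q hqI hqT hlq hxq h
      · exact hxw (h hxq)
    obtain ⟨hpI, hpT⟩ : p ∉ I ∧ G.trace I p ⊂ T := by
      refine hp.resolve_left fun h => ?_
      exact Finset.disjoint_left.1 hdisj (mem_trace.2 ⟨hTI h, hwp⟩)
        (mem_trace.2 ⟨hTI h, hpq.symm⟩)
    -- A vertex `b` violating this gives the induced path `b - w - p - q - x`; maximality then
    -- yields equality.
    have hsub : G.trace I w ⊆ G.trace I p := by
      intro b hb
      by_contra hbp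
      have hbq := Finset.disjoint_left.1 hdisj hb
      rw [mem_trace] at hb hbp hbq
      exact hI.path_free.false_of_path hb.2.symm hwp hpq hqx (fun e => hbp ⟨hb.1, e.symm⟩)
        (fun e => hbq ⟨hb.1, e.symm⟩) (hI.indep _ hb.1 _ hxI) hwq
        (fun e => hxw (mem_trace.2 ⟨hxI, e⟩)) hpx
    have heq : G.trace I p = G.trace I w :=
      (Finset.eq_of_subset_of_card_le hsub (hmax p hpI hpT (.single ⟨hwp, hp⟩))).symm
    exact ⟨p, q, heq, hpq, hxq, hedge p q hqI hqT hlq hxq heq hpq, Or.inr hdisj⟩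

/-- Each class vertex `x` outside the trace of `w` has its own neighbour `q x`; excluding induced
`P₅`s makes these pairwise adjacent, so there are at most five. -/
theorem linkClass_card_le_of_isMax (hw : w ∉ I)
    (hmax : ∀ v, v ∉ I → G.trace I v ⊂ T → G.Linked I T w v →
      (G.trace I v).card ≤ (G.trace I w).card)
    (hTI : T ⊆ I) : (G.linkClass I T w).card ≤ (G.trace I w).card + 5 := by
  classical
  have key : ∀ x ∈ G.linkClass I T w \ G.trace I w, ∃ p q, G.trace I p = G.trace I w ∧
      G.Adj p q ∧ x ∈ G.trace I q ∧ (∀ y ∈ G.trace I q, y ∉ G.trace I w → y = x) ∧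
      (p = w ∨ Disjoint (G.trace I w) (G.trace I q)) := by
    intro x hx
    rw [Finset.mem_sdiff, mem_linkClass] at hx
    exact hI.exists_edge_to hw hmax hTI hx.1.1 hx.2 hx.1.2
  choose! p q hp hpq hxq hq hor using key
  have hcard : (G.linkClass I T w \ G.trace I w).card ≤ 5 := by
    refine hI.card_le_of_pairwise_adj q fun x hx y hy hxy => ?_
    by_contra hadj
    have mem : ∀ x ∈ G.linkClass I T w \ G.trace I w, x ∈ I ∧ x ∉ G.trace I w := fun x hx => by
      rw [Finset.mem_sdiff, mem_linkClass] at hx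
      exact ⟨hTI hx.1.1, hx.2⟩
    have hqx : ∀ x ∈ G.linkClass I T w \ G.trace I w, G.Adj (q x) x := fun x hx =>
      (mem_trace.1 (hxq x hx)).2
    have hpn : ∀ x ∈ G.linkClass I T w \ G.trace I w,
        ∀ y ∈ G.linkClass I T w \ G.trace I w, ¬ G.Adj (p x) y := fun x hx y hy e =>
      (mem y hy).2 (hp x hx ▸ mem_trace.2 ⟨(mem y hy).1, e⟩)
    have hqn : ∀ x ∈ G.linkClass I T w \ G.trace I w,
        ∀ y ∈ G.linkClass I T w \ G.trace I w, x ≠ y → ¬ G.Adj (q x) y :=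
      fun x hx y hy hxy e =>
        hxy (hq x hx y (mem_trace.2 ⟨(mem y hy).1, e⟩) (mem y hy).2).symm
    have hcross : ∀ x ∈ G.linkClass I T w \ G.trace I w,
        ∀ y ∈ G.linkClass I T w \ G.trace I w, x ≠ y → ¬ G.Adj (q x) (q y) →
          ¬ G.Adj (q x) (p y) := fun x hx y hy hxy hadj e =>
      hI.path_free.false_of_path (hqx x hx).symm e (hpq y hy) (hqx y hy)
        (fun e => hpn y hy x hx e.symm) (fun e => hqn y hy x hx hxy.symm e.symm)
        (hI.indep _ (mem x hx).1 _ (mem y hy).1) hadj (hqn x hx y hy hxy) (hpn y hy y hy)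
    have hfar : ∀ x ∈ G.linkClass I T w \ G.trace I w,
        ∀ y ∈ G.linkClass I T w \ G.trace I w, x ≠ y → ¬ G.Adj (q x) (q y) →
          ¬ G.Adj (p x) (p y) → p x = w := by
      intro x hx y hy hxy hadj hpp
      refine (hor x hx).resolve_right fun hdisj => ?_
      obtain ⟨a, ha⟩ := hI.trace_nonempty hw
      have haq := Finset.disjoint_left.1 hdisj ha
      have hapx := hp x hx ▸ ha
      have hapy := hp y hy ▸ ha
      rw [mem_trace] at haq ha hapx hapy
      exact hI.path_free.false_of_path (hqx x hx).symm (hpq x hx).symm hapx.2 hapy.2.symm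
        (fun e => hpn x hx x hx e.symm) (hI.indep _ (mem x hx).1 _ ha.1)
        (fun e => hpn y hy x hx e.symm) (fun e => haq ⟨ha.1, e⟩) (hcross x hx y hy hxy hadj) hpp
    have hadj' : ¬ G.Adj (q y) (q x) := fun e => hadj e.symm
    by_cases hpp : G.Adj (p x) (p y)
    · exact hI.path_free.false_of_path (hqx x hx).symm (hpq x hx).symm hpp (hpq y hy)
        (fun e => hpn x hx x hx e.symm) (fun e => hpn y hy x hx e.symm)
        (fun e => hqn y hy x hx hxy.symm e.symm) (hcross x hx y hy hxy hadj) hadj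
        (fun e => hcross y hy x hx hxy.symm hadj' e.symm)
    · have e1 := hfar x hx y hy hxy hadj hpp
      have e2 := hfar y hy x hx hxy.symm hadj' fun e => hpp e.symm
      exact hcross x hx y hy hxy hadj (e2 ▸ e1 ▸ (hpq x hx).symm)
  have := Finset.card_le_card_sdiff_add_card (s := G.linkClass I T w) (t := G.trace I w)
  omega

theorem linkClass_card (hTI : T ⊆ I) (hx : x ∈ T) :
    (G.linkClass I T x).card ≤ 1 ∨ ∃ w, w ∉ I ∧ G.trace I w ⊂ T ∧
      (G.linkClass I T x).card ≤ (G.trace I w).card + 5 := by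
  classical
  by_cases h : ∃ w, w ∉ I ∧ G.trace I w ⊂ T ∧ G.Linked I T x w
  -- Minimising the deficit `I.card - (G.trace I w).card` picks a linked `w` of maximum trace.
  · have hbdd : ∃ n, ∃ w, w ∉ I ∧ G.trace I w ⊂ T ∧ G.Linked I T x w ∧
        I.card - (G.trace I w).card = n := by
      obtain ⟨w, h1, h2, h3⟩ := h
      exact ⟨_, w, h1, h2, h3, rfl⟩
    obtain ⟨w, hw, hwT, hxw, hn⟩ := Nat.find_spec hbdd
    have hwx := hxw.symm (Or.inl hx)
    have hmax : ∀ v, v ∉ I → G.trace I v ⊂ T → G.Linked I T w v →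
        (G.trace I v).card ≤ (G.trace I w).card := by
      intro v hv hvT hwv
      have := Nat.find_min' hbdd ⟨v, hv, hvT, hxw.trans hwv, rfl⟩
      have h1 : (G.trace I v).card ≤ I.card := Finset.card_le_card trace_subset
      have h2 : (G.trace I w).card ≤ I.card := Finset.card_le_card trace_subset
      omega
    refine Or.inr ⟨w, hw, hwT, (Finset.card_le_card fun y hy => ?_).trans
      (hI.linkClass_card_le_of_isMax hw hmax hTI)⟩
    rw [mem_linkClass] at hy ⊢
    exact ⟨hy.1, hwx.trans hy.2⟩
  · refine Or.inl (Finset.card_le_one.2 ?_)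
    suffices H : ∀ y ∈ G.linkClass I T x, x = y from fun a ha b hb => (H a ha).symm.trans (H b hb)
    intro y hy
    rcases Relation.ReflTransGen.cases_head (mem_linkClass.1 hy).2 with h1 | ⟨c, hc, _⟩
    · exact h1
    · rcases hc.2 with h2 | h2
      · exact (hI.indep _ (hTI hx) _ (hTI h2) hc.1).elim
      · exact (h ⟨c, h2.1, h2.2, .single hc⟩).elim

/-! ### Descent to smaller traces. -/

/-- If all vertices attached to `G.below I T` from outside see all of `T` up to few exceptions,
then `T` nearly contains a large trace. -/
theorem exists_large_trace (hG : G.IsVertexCritical 5) (hTI : T ⊆ I) (hT : 12 < T.card)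
    {B : Finset V} (hB : B.card ≤ 5)
    (hout : ∀ z ∉ I, ¬ G.trace I z ⊂ T → ∀ v ∈ G.below I T, G.Adj z v →
      (∀ x ∈ T, x ∉ B → x ∈ G.trace I z) ∧
        ∀ a ∈ T, ∀ b ∈ T, a ∉ G.trace I z → b ∉ G.trace I z → a = b) :
    ∃ w, w ∉ I ∧ G.trace I w ⊂ T ∧ T.card ≤ 6 * ((G.trace I w).card + 5) := by
  classical
  by_contra! hcon
  have hself : ∀ x ∈ T, x ∈ G.linkClass I T x := fun x hx => mem_linkClass.2 ⟨hx, .refl⟩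
  have hsmall : ∀ x ∈ T, (G.linkClass I T x).card ≤ (T.card - 1) / 6 := by
    intro x hx
    rcases hI.linkClass_card hTI hx with h | ⟨w, hw, hwT, h⟩
    · omega
    · have := hcon w hw hwT
      omega
  have hmany : 7 ≤ (T.image (G.linkClass I T)).card := by
    have h1 := Finset.card_le_mul_card_image (f := G.linkClass I T) T ((T.card - 1) / 6) (by
      intro b hb
      obtain ⟨x, hx, rfl⟩ := Finset.mem_image.1 hb
      refine (Finset.card_le_card fun y hy => ?_).trans (hsmall x hx)
      rw [Finset.mem_filter] at hy
      exact hy.2 ▸ hself y hy.1)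
    by_contra hlt
    have h2 := Nat.mul_le_mul_left ((T.card - 1) / 6) (Nat.le_of_lt_succ (Nat.lt_of_not_le hlt))
    omega
  have htwo : 1 < (T.image (G.linkClass I T) \ B.image (G.linkClass I T)).card := by
    have h1 := Finset.card_le_card_sdiff_add_card (s := T.image (G.linkClass I T))
      (t := B.image (G.linkClass I T))
    have h2 : (B.image (G.linkClass I T)).card ≤ B.card := Finset.card_image_le
    omega
  obtain ⟨C₁, hC₁, C₂, hC₂, hne⟩ := Finset.one_lt_card.1 htwo
  rw [Finset.mem_sdiff, Finset.mem_image] at hC₁ hC₂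
  obtain ⟨⟨x₁, hx₁, rfl⟩, hxB₁⟩ := hC₁
  obtain ⟨⟨x₂, hx₂, rfl⟩, hxB₂⟩ := hC₂
  have hclass : ∀ x y, x ∈ T → G.Linked I T x y → G.linkClass I T x = G.linkClass I T y := by
    intro x y hx hxy
    ext t
    rw [mem_linkClass, mem_linkClass]
    exact and_congr_right fun _ => ⟨(hxy.symm (Or.inl hx)).trans, hxy.trans⟩
  have hsep : ∀ v, G.Linked I T x₁ v → ¬ G.Linked I T x₂ v := fun v h1 h2 =>
    hne (hclass _ _ hx₁ (h1.trans (h2.symm (Or.inl hx₂))))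
  have hcomplete : ∀ z ∉ I, ¬ G.trace I z ⊂ T → ∀ v ∈ G.below I T, G.Adj z v →
      ∀ x ∈ T, G.linkClass I T x ∉ B.image (G.linkClass I T) →
        ∀ w, G.Linked I T x w → G.Adj z w := by
    intro z hz hzT v hv hzv x hx hxB w hxw
    obtain ⟨h1, h2⟩ := hout z hz hzT v hv hzv
    have hmem : ∀ y ∈ T, G.Linked I T x y → y ∈ G.trace I z := fun y hy hxy =>
      h1 y hy fun hyB => hxB (Finset.mem_image.2 ⟨y, hyB, (hclass x y hx hxy).symm⟩)
    rcases hxw.mem_below (Or.inl hx) with hwT | ⟨hwI, hwT⟩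
    · exact (mem_trace.1 (hmem w hwT hxw)).2
    · have hwx : ∀ y ∈ G.trace I w, G.Linked I T x y := fun y hy =>
        hxw.tail ⟨(mem_trace.1 hy).2, Or.inl (hwT.1 hy)⟩
      by_contra hzw
      obtain ⟨b, hb⟩ := hI.trace_nonempty hwI
      have hbz := hmem b (hwT.1 hb) (hwx b hb)
      have hcard : 2 < (T \ G.linkClass I T x).card := by
        have h3 := Finset.card_le_card_sdiff_add_card (s := T) (t := G.linkClass I T x)
        have h4 := hsmall x hx
        omega
      have hoff : ∀ y ∈ T \ G.linkClass I T x, y ∈ T ∧ y ∉ G.trace I w := by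
        intro y hy
        rw [Finset.mem_sdiff] at hy
        exact ⟨hy.1, fun hyw => hy.2 (mem_linkClass.2 ⟨hy.1, hwx y hyw⟩)⟩
      -- Off the class, the trace of `z` contains at most one vertex of `T` and misses at most one,
      -- so three are too many.
      obtain ⟨p, q, r, hp, hq, hr, hpq, hpr, hqr⟩ := Finset.two_lt_card_iff.1 hcard
      have eqz : ∀ s ∈ T \ G.linkClass I T x, ∀ t ∈ T \ G.linkClass I T x,
          s ∈ G.trace I z → t ∈ G.trace I z → s = t := fun s hs t ht hsz htz =>
        hI.eq_of_not_adj (fun e => hzw e.symm) hb hbz hsz (hoff s hs).2 htz (hoff t ht).2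
      have eqo : ∀ s ∈ T \ G.linkClass I T x, ∀ t ∈ T \ G.linkClass I T x,
          s ∉ G.trace I z → t ∉ G.trace I z → s = t := fun s hs t ht =>
        h2 s (hoff s hs).1 t (hoff t ht).1
      by_cases hpz : p ∈ G.trace I z <;> by_cases hqz : q ∈ G.trace I z <;>
        by_cases hrz : r ∈ G.trace I z <;>
        first
        | exact hpq (eqz p hp q hq hpz hqz)
        | exact hpq (eqo p hp q hq hpz hqz)
        | exact hpr (eqz p hp r hr hpz hrz)
        | exact hpr (eqo p hp r hr hpz hrz)
        | exact hqr (eqz q hq r hr hqz hrz)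
        | exact hqr (eqo q hq r hr hqz hrz)
  refine hG.false_of_twin_modules (M₁ := {v | G.Linked I T x₁ v}) (M₂ := {v | G.Linked I T x₂ v})
    ⟨x₁, .refl⟩ ⟨x₂, .refl⟩ (Set.disjoint_left.2 hsep) (fun a ha b hb hab => ?_)
    (fun z hz₁ hz₂ v hv hzv w hw => ?_)
  · exact hsep b (Relation.ReflTransGen.tail ha ⟨hab, Linked.mem_below hb (Or.inl hx₂)⟩) hb
  · have hvb : v ∈ G.below I T :=
      hv.elim (fun h => Linked.mem_below h (Or.inl hx₁)) fun h => Linked.mem_below h (Or.inl hx₂)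
    have hzb : z ∉ G.below I T := fun h => hv.elim
      (fun hv => hz₁ (Relation.ReflTransGen.tail hv ⟨hzv.symm, h⟩))
      fun hv => hz₂ (Relation.ReflTransGen.tail hv ⟨hzv.symm, h⟩)
    have hzI : z ∉ I := by
      intro hzI
      rcases hvb with h | ⟨_, h⟩
      · exact hI.indep _ hzI _ (hTI h) hzv
      · exact hzb (Or.inl (h.1 (mem_trace.2 ⟨hzI, hzv.symm⟩)))
    have hzT : ¬ G.trace I z ⊂ T := fun h => hzb (Or.inr ⟨hzI, h⟩)
    exact hw.elim (hcomplete z hzI hzT v hvb hzv x₁ hx₁ hxB₁ w)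
      (hcomplete z hzI hzT v hvb hzv x₂ hx₂ hxB₂ w)

theorem trace_of_attached {u : V} (hT : 4 ≤ (G.trace I u).card) (hz : z ∉ I)
    (hzu : ¬ G.trace I z ⊂ G.trace I u) (hv : v ∈ G.below I (G.trace I u)) (hzv : G.Adj z v) :
    G.trace I u ⊆ G.trace I z ∨ G.Adj u z ∧ ¬ G.trace I z ⊆ G.trace I u ∧
      ∀ a ∈ G.trace I u, ∀ b ∈ G.trace I u, a ∉ G.trace I z → b ∉ G.trace I z → a = b := by
  classical
  -- If the traces were disjoint, an attaching `v` outside `I` would see at most one vertex of `I`,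
  -- and `u` would centre a chair with long arm `u - v - z`.
  have hmeet : ∃ b, b ∈ G.trace I u ∧ b ∈ G.trace I z := by
    by_contra! hdisj
    obtain ⟨c, hc⟩ := hI.trace_nonempty hz
    have hcu : c ∉ G.trace I u := fun h => hdisj c h hc
    obtain ⟨a, ha, b, hb, hab⟩ := Finset.one_lt_card.1 (show 1 < (G.trace I u).card by omega)
    have huz : ¬ G.Adj u z := fun e =>
      hab (hI.eq_of_adj e ha (hdisj a ha) hb (hdisj b hb) hc hcu)
    rcases hv with hv | ⟨hvI, hvT⟩
    · exact hdisj v hv (mem_trace.2 ⟨trace_subset hv, hzv⟩)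
    · obtain ⟨d, hd⟩ := hI.trace_nonempty hvI
      have hcv : c ∉ G.trace I v := fun h => hcu (hvT.1 h)
      have hcard : (G.trace I v).card ≤ 1 := Finset.card_le_one.2 fun s hs t ht =>
        hI.eq_of_adj hzv.symm hs (hdisj s (hvT.1 hs)) ht (hdisj t (hvT.1 ht)) hc hcv
      have h1 := Finset.card_le_card_sdiff_add_card (s := G.trace I u) (t := G.trace I v)
      obtain ⟨s, hs, t, ht, hst⟩ :=
        Finset.one_lt_card.1 (show 1 < (G.trace I u \ G.trace I v).card by omega)
      rw [Finset.mem_sdiff] at hs ht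
      have huv : G.Adj u v := by
        by_contra huv
        exact hst (hI.eq_of_not_adj (fun e => huv e.symm) hd (hvT.1 hd) hs.1 hs.2 ht.1 ht.2)
      have hsz := hdisj s hs.1
      have htz := hdisj t ht.1
      simp only [mem_trace] at hs ht hsz htz
      exact hI.chair_free.false_of_chair hs.1.2 ht.1.2 huv hzv.symm hst
        (hI.indep _ hs.1.1 _ ht.1.1) (fun e => hs.2 ⟨hs.1.1, e.symm⟩)
        (fun e => ht.2 ⟨ht.1.1, e.symm⟩) (fun e => hsz ⟨hs.1.1, e.symm⟩)
        (fun e => htz ⟨ht.1.1, e.symm⟩) huz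
  by_cases hsub : G.trace I z ⊆ G.trace I u
  · left
    by_contra h
    exact hzu ⟨hsub, h⟩
  by_cases hsub' : G.trace I u ⊆ G.trace I z
  · exact Or.inl hsub'
  obtain ⟨b, hbu, hbz⟩ := hmeet
  have huz : G.Adj u z := by
    by_contra huz
    exact (hI.nested_of_not_adj huz hbu hbz).elim hsub' hsub
  obtain ⟨c, hc, hcu⟩ := Finset.not_subset.1 hsub
  exact Or.inr ⟨huz, hsub, fun s hs t ht hsz htz => hI.eq_of_adj huz hs hsz ht htz hc hcu⟩

/-- The exceptional vertices are those that some attached `z` alone misses. Witnesses for distinct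
ones have meeting, incomparable traces, hence are adjacent, so at most five occur. -/
theorem exists_large_trace_of_trace (hG : G.IsVertexCritical 5) (u : V)
    (hT : 12 < (G.trace I u).card) :
    ∃ w, w ∉ I ∧ G.trace I w ⊂ G.trace I u ∧
      (G.trace I u).card ≤ 6 * ((G.trace I w).card + 5) := by
  classical
  set T := G.trace I u with hTdef
  let P : V → V → Prop := fun a z => G.Adj u z ∧ ¬ G.trace I z ⊆ T ∧ a ∉ G.trace I z ∧
    ∀ b ∈ T, b ∉ G.trace I z → b = a
  refine hI.exists_large_trace hG trace_subset hT (B := T.filter fun a => ∃ z, P a z) ?_ ?_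
  · have key : ∀ a ∈ T.filter fun a => ∃ z, P a z, ∃ z, P a z := fun a ha =>
      (Finset.mem_filter.1 ha).2
    choose! f hf using key
    refine hI.card_le_of_pairwise_adj f fun x hx y hy hxy => ?_
    obtain ⟨_, _, h3, h4⟩ := hf x hx
    obtain ⟨_, _, h7, h8⟩ := hf y hy
    have hxT := (Finset.mem_filter.1 hx).1
    have hyT := (Finset.mem_filter.1 hy).1
    have hcard : 0 < (T \ {x, y}).card := by
      have h1 := Finset.card_le_card_sdiff_add_card (s := T) (t := {x, y})
      have h2 : ({x, y} : Finset V).card ≤ 2 := Finset.card_le_two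
      omega
    obtain ⟨b, hb⟩ := Finset.card_pos.1 hcard
    simp only [Finset.mem_sdiff, Finset.mem_insert, Finset.mem_singleton, not_or] at hb
    have hbx : b ∈ G.trace I (f x) := by
      by_contra h
      exact hb.2.1 (h4 b hb.1 h)
    have hby : b ∈ G.trace I (f y) := by
      by_contra h
      exact hb.2.2 (h8 b hb.1 h)
    by_contra hadj
    rcases hI.nested_of_not_adj hadj hbx hby with h | h
    · refine h7 (h ?_)
      by_contra h'
      exact hxy (h4 y hyT h').symm
    · refine h3 (h ?_)
      by_contra h'
      exact hxy (h8 x hxT h')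
  · intro z hz hzT v hv hzv
    rcases hI.trace_of_attached (show 4 ≤ T.card by omega) hz hzT hv hzv with h | ⟨h1, h2, h3⟩
    · exact ⟨fun x hx _ => h hx, fun a ha _ _ haz => (haz (h ha)).elim⟩
    · refine ⟨fun x hx hxB => ?_, h3⟩
      by_contra hxz
      exact hxB (Finset.mem_filter.2 ⟨hx, z, h1, h2, hxz, fun b hb hbz => h3 b hb x hx hbz hxz⟩)

theorem exists_large_trace_of_card (hG : G.IsVertexCritical 5) (hcard : 12 < I.card) :
    ∃ w, w ∉ I ∧ I.card ≤ 6 * ((G.trace I w).card + 5) := by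
  obtain ⟨w, hw, _, h⟩ := hI.exists_large_trace hG Finset.Subset.rfl hcard (B := ∅) (by simp)
    fun z _ hzI v _ _ => by
      have hsub : I ⊆ G.trace I z := by
        by_contra h
        exact hzI ⟨trace_subset, h⟩
      exact ⟨fun x hx _ => hsub hx, fun a ha _ _ haz => (haz (hsub ha)).elim⟩
  exact ⟨w, hw, h⟩

/-! ### Cliques and the final bound. -/

/-- A large trace yields a large clique of vertices whose traces it contains. -/
theorem exists_clique (hG : G.IsVertexCritical 5) (d : ℕ) :
    ∀ u, u ∉ I → 1000 * 37 ^ d ≤ (G.trace I u).card → ∃ s : Finset V, G.IsClique s ∧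
      s.card = d ∧ ∀ v ∈ s, v ∉ I ∧ G.trace I v ⊆ G.trace I u := by
  classical
  induction d with
  | zero => exact fun u _ _ => ⟨∅, by simp, rfl, by simp⟩
  | succ d ih =>
    intro u hu hcard
    rw [pow_succ] at hcard
    have hpos : 0 < 37 ^ d := by positivity
    -- Two descents leave a gap of at least two vertices, forcing `u` to be adjacent to the whole
    -- smaller clique. They cost `t ≤ 36 * t'' + 210`; the factors 37 and 1000 absorb the constant.
    obtain ⟨w₁, hw₁, hsub₁, h₁⟩ := hI.exists_large_trace_of_trace hG u (by omega)
    obtain ⟨w₂, hw₂, hsub₂, h₂⟩ := hI.exists_large_trace_of_trace hG w₁ (by omega)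
    obtain ⟨s, hs, hsc, hst⟩ := ih w₂ hw₂ (by omega)
    obtain ⟨a, hau, haw⟩ := Finset.exists_of_ssubset hsub₁
    obtain ⟨b, hbw, hbw'⟩ := Finset.exists_of_ssubset hsub₂
    have hadj : ∀ v ∈ s, G.Adj u v := by
      intro v hv
      by_contra huv
      obtain ⟨hvI, hvw⟩ := hst v hv
      obtain ⟨c, hc⟩ := hI.trace_nonempty hvI
      have hab := hI.eq_of_not_adj (fun e => huv e.symm) hc (hsub₁.1 (hsub₂.1 (hvw hc))) hau
        (fun h => haw (hsub₂.1 (hvw h))) (hsub₁.1 hbw) (fun h => hbw' (hvw h))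
      exact haw (hab ▸ hbw)
    have hus : u ∉ s := fun h => (hadj u h).ne rfl
    refine ⟨insert u s, ?_, by rw [Finset.card_insert_of_notMem hus, hsc], fun v hv => ?_⟩
    · rw [Finset.coe_insert]
      exact hs.insert fun v hv _ => hadj v hv
    · rcases Finset.mem_insert.1 hv with rfl | hv
      · exact ⟨hu, Finset.Subset.rfl⟩
      · exact ⟨(hst v hv).1, (hst v hv).2.trans (hsub₂.1.trans hsub₁.1)⟩

theorem card_le (hG : G.IsVertexCritical 5) : I.card ≤ 6000 * 37 ^ 6 + 30 := by
  by_contra! hlt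
  obtain ⟨w, hw, h⟩ := hI.exists_large_trace_of_card hG (by omega)
  obtain ⟨s, hs, hsc, _⟩ := hI.exists_clique hG 6 w hw (by omega)
  have := hI.clique_card_le s hs
  omega

end SimpleGraph.IsAnchor

end Traces

theorem SimpleGraph.IsVertexCritical.card_le_of_indFree {V : Type*} [Fintype V]
    {G : SimpleGraph V} (hG : G.IsVertexCritical 5) (hP : G.IndFree (pathGraph 5))
    (hC : G.IndFree chairGraph) : Fintype.card V ≤ 5 * (6000 * 37 ^ 6 + 30) := by
  classical
  obtain ⟨I, hind, hmax⟩ := Finset.exists_max_image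
    (Finset.univ.filter fun I : Finset V => ∀ a ∈ I, ∀ b ∈ I, ¬ G.Adj a b) Finset.card
    ⟨∅, by simp⟩
  simp only [Finset.mem_filter, Finset.mem_univ, true_and] at hind hmax
  have hI : G.IsAnchor I := by
    refine ⟨hP, hC, hind, fun v hv => ?_, hG.clique_card_le⟩
    by_contra! hno
    have := hmax (insert v I) (by
      simp only [Finset.mem_insert]
      rintro a (rfl | ha) b (rfl | hb)
      · exact G.irrefl
      · exact hno b hb
      · exact fun e => hno a ha e.symm
      · exact hind a ha b hb)
    rw [Finset.card_insert_of_notMem hv] at this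
    omega
  obtain ⟨c⟩ : G.Colorable 5 := chromaticNumber_le_iff_colorable.1 hG.1.le
  have hfib := Finset.card_le_mul_card_image (f := c) Finset.univ I.card fun i _ =>
    hmax _ fun a ha b hb hab => c.valid hab
      ((Finset.mem_filter.1 ha).2.trans (Finset.mem_filter.1 hb).2.symm)
  have himg : (Finset.univ.image c).card ≤ 5 := by
    simpa using Finset.card_le_univ (Finset.univ.image c)
  calc Fintype.card V ≤ I.card * (Finset.univ.image c).card := hfib
    _ ≤ (6000 * 37 ^ 6 + 30) * 5 := Nat.mul_le_mul (hI.card_le hG) himg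
    _ = _ := Nat.mul_comm _ _

theorem mainTheorem1 :
    ∃ S : Set (Σ n : ℕ, SimpleGraph (Fin n)), S.Finite ∧
      ∀ (V : Type*) [Finite V] (G : SimpleGraph V),
        G.IsVertexCritical 5 → G.IndFree (SimpleGraph.pathGraph 5) → G.IndFree chairGraph →
          ∃ F ∈ S, Nonempty (G ≃g F.2) := by
  refine ⟨Set.range fun p : Σ n : Fin (5 * (6000 * 37 ^ 6 + 30) + 1), SimpleGraph (Fin n) =>
    ⟨p.1, p.2⟩, Set.finite_range _, fun V _ G hG hP hC => ?_⟩
  have := Fintype.ofFinite V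
  have hle := hG.card_le_of_indFree hP hC
  have e := Fintype.equivFin V
  exact ⟨⟨Fintype.card V, G.map e.toEmbedding⟩,
    ⟨⟨⟨Fintype.card V, Nat.lt_succ_of_le hle⟩, G.map e.toEmbedding⟩, rfl⟩, ⟨Iso.map e G⟩⟩
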